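/- For a composition $\alpha$ of $n\ge 0$ let $S_\alpha\subseteq[n-1]$ be its set of partial sums, and let $\omega(\alpha)$ be the composition of $n$ with $S_{\omega(\alpha)}=[n-1]\setminus S_{rev(\alpha)}$, where $rev(\alpha)$ is $\alpha$ read backwards. Let $w=w_\alpha\in\mathfrak S_n$ be a permutation with descent set $S_\alpha$. Let $\tilde L_\alpha=\sum_\sigma\prod_{i\ge1} x_i^{\#\{j\,:\,i\in\sigma(j)\}}\in\mathbb Z[[x_1,x_2,\dots]]$, the sum being over all maps $\sigma$ from the chain $1<\dots<n$ to nonempty finite sets of positive integers with $\max\sigma(j)\le\min\sigma(j+1)$ if $w_j<w_{j+1}$ and $\max\sigma(j)<\min\sigma(j+1)$ if $w_j>w_{j+1}$. Let $\hat L_\alpha$ be the same sum with nonempty finite multisets in place of nonempty finite sets (exponents counted with multiplicity), and let $L_\alpha$ be the same sum over maps to positive integers, i.e. the fundamental quasisymmetric function. Let $\mathfrak m\mathrm{QSym}=\prod_\alpha\mathbb Z\tilde L_\alpha$ be the space of all (possibly infinite) $\mathbb Z$-linear combinations of the $\tilde L_\alpha$, where $\alpha$ runs over all compositions, with the topology induced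 by the filtration by degree, and let $\omega$ be the linear map, respecting arbitrary linear combinations, with $\omega(L_\alpha)=L_{\omega(\alpha)}$ for every $\alpha$. Then $\omega$ maps $\mathfrak m\mathrm{QSym}$ to itself and is an involution on it; for every composition $\alpha$, $\omega(\tilde L_\alpha)=\hat L_{\omega(\alpha)}$; and $\{\hat L_\alpha\}$ is a continuous basis of $\mathfrak m\mathrm{QSym}$: every (possibly infinite) $\mathbb Z$-linear combination of the $\hat L_\alpha$ converges to an element of $\mathfrak m\mathrm{QSym}$, and every element of $\mathfrak m\mathrm{QSym}$ is such a combination in exactly one way. -/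

import Mathlib

namespace MQSym

open Finset

noncomputable section

/-! ### Compositions -/

/-- The set `S_α = {α₁, α₁ + α₂, …, α₁ + ⋯ + α_{k-1}} ⊆ [n-1]` of a composition `α` of `n`. -/
def partialSums {n : ℕ} (α : Composition n) : Finset ℕ :=
  (Finset.Ico 1 α.length).image α.sizeUpTo

/-- The composition `C(S)` of `n` attached to a set `S ⊆ [n-1]`
(elements of `S` outside `[n-1]` are ignored): the composition whose partial sums form `S`. -/
def compOfSet (n : ℕ) (S : Finset ℕ) : Composition n :=
  CompositionAsSet.toComposition
    { boundaries := Finset.univ.filter fun k : Fin (n + 1) =>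
        (k : ℕ) = 0 ∨ (k : ℕ) = n ∨ (k : ℕ) ∈ S
      zero_mem := by simp
      getLast_mem := by simp }

theorem mem_partialSums_iff_mem_boundaries {n : ℕ} (α : Composition n) (k : Fin (n + 1)) :
    (k : ℕ) ∈ partialSums α ↔ k ∈ α.boundaries ∧ 0 < (k : ℕ) ∧ (k : ℕ) < n := by
  have hmono : ∀ i j, i < j → j ≤ α.length → α.sizeUpTo i < α.sizeUpTo j := by
    intro i j hij hj
    exact (α.sizeUpTo_strict_mono (by omega)).trans_le (α.monotone_sizeUpTo hij)
  simp only [partialSums, mem_image, mem_Ico, Composition.boundaries, mem_map, mem_univ, true_and]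
  constructor
  · rintro ⟨i, ⟨h1, h2⟩, h3⟩
    refine ⟨⟨⟨i, by omega⟩, ?_⟩, ?_, ?_⟩
    · ext; simpa [Composition.boundary] using h3
    · have := hmono 0 i (by omega) h2.le
      simp at this; omega
    · have := hmono i α.length h2 le_rfl
      rw [α.sizeUpTo_length] at this; omega
  · rintro ⟨⟨i, hi⟩, h0, hn⟩
    have hk : α.sizeUpTo i = k := by rw [← hi]; simp [Composition.boundary]
    refine ⟨i, ⟨?_, ?_⟩, hk⟩
    · rcases Nat.eq_zero_or_pos (i : ℕ) with h | h
      · rw [h, α.sizeUpTo_zero] at hk; omega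
      · exact h
    · by_contra hc
      rw [α.sizeUpTo_ofLength_le _ (by omega)] at hk; omega

theorem partialSums_subset {n : ℕ} (α : Composition n) : partialSums α ⊆ Finset.Ico 1 n := by
  intro x hx
  have hx' : x < n + 1 := by
    simp only [partialSums, mem_image] at hx
    obtain ⟨i, -, rfl⟩ := hx
    have := α.sizeUpTo_le i; omega
  have := (mem_partialSums_iff_mem_boundaries α ⟨x, hx'⟩).1 hx
  simp at this ⊢; omega

/-- `S ↦ C(S)` is a section of `α ↦ S_α` on subsets of `[n-1]`. -/
theorem partialSums_compOfSet {n : ℕ} {S : Finset ℕ} (hS : S ⊆ Finset.Ico 1 n) :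
    partialSums (compOfSet n S) = S := by
  ext x
  constructor
  · intro hx
    have h1 := mem_Ico.1 (partialSums_subset _ hx)
    have := (mem_partialSums_iff_mem_boundaries _ ⟨x, by omega⟩).1 hx
    rw [compOfSet, CompositionAsSet.toComposition_boundaries] at this
    simp at this
    rcases this.1 with h | h | h
    · omega
    · omega
    · exact h
  · intro hx
    have h1 := mem_Ico.1 (hS hx)
    refine (mem_partialSums_iff_mem_boundaries _ ⟨x, by omega⟩).2 ⟨?_, ?_, ?_⟩
    · rw [compOfSet, CompositionAsSet.toComposition_boundaries]
      simp [hx]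
    · simp; omega
    · simp; omega

theorem partialSums_injective {n : ℕ} : Function.Injective (partialSums (n := n)) := by
  intro α β h
  apply (compositionEquiv n).injective
  apply CompositionAsSet.ext
  change α.boundaries = β.boundaries
  have hz : ∀ γ : Composition n, (0 : Fin (n + 1)) ∈ γ.boundaries := fun γ =>
    γ.toCompositionAsSet.zero_mem
  have hl : ∀ γ : Composition n, Fin.last n ∈ γ.boundaries := fun γ =>
    γ.toCompositionAsSet.getLast_mem
  ext k
  by_cases h0 : (k : ℕ) = 0
  · have : k = 0 := by ext; simpa using h0
    subst this; simp [hz]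
  by_cases hn : (k : ℕ) = n
  · have : k = Fin.last n := by ext; simpa using hn
    subst this; simp [hl]
  have hk := k.isLt
  have h1 := mem_partialSums_iff_mem_boundaries α k
  have h2 := mem_partialSums_iff_mem_boundaries β k
  rw [h] at h1
  have h3 : 0 < (k : ℕ) ∧ (k : ℕ) < n := by omega
  tauto

/-- The composition `ω(α)` of `n`: its partial sums are the complement in `[n-1]` of the partial
sums of the reversed composition. -/
def omegaComp {n : ℕ} (α : Composition n) : Composition n :=
  compOfSet n (Finset.Ico 1 n \ partialSums α.reverse)

theorem index_lt_iff {n : ℕ} (α : Composition n) (i j : Fin n) (h : (i : ℕ) + 1 = j) :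
    (α.index i : ℕ) < α.index j ↔ (j : ℕ) ∈ partialSums α := by
  have a1 := α.sizeUpTo_index_le i
  have a2 := α.lt_sizeUpTo_index_succ i
  have b1 := α.sizeUpTo_index_le j
  have b2 := α.lt_sizeUpTo_index_succ j
  simp only [Fin.val_succ] at a2 b2
  simp only [partialSums, mem_image, mem_Ico]
  constructor
  · intro hlt
    refine ⟨α.index j, ⟨by omega, (α.index j).isLt⟩, ?_⟩
    have := α.monotone_sizeUpTo (show (α.index i : ℕ) + 1 ≤ α.index j from hlt)
    omega
  · rintro ⟨k, ⟨k1, k2⟩, hk⟩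
    have h1 : (α.index i : ℕ) < k := by
      by_contra hc
      have := α.monotone_sizeUpTo (show k ≤ α.index i by omega)
      omega
    have h2 : k ≤ α.index j := by
      by_contra hc
      have := α.monotone_sizeUpTo (show (α.index j : ℕ) + 1 ≤ k by omega)
      omega
    omega

theorem index_mono {n : ℕ} (α : Composition n) (i j : Fin n) (h : i ≤ j) :
    (α.index i : ℕ) ≤ α.index j := by
  by_contra hc
  have a1 := α.sizeUpTo_index_le i
  have b2 := α.lt_sizeUpTo_index_succ j
  simp only [Fin.val_succ] at b2
  have := α.monotone_sizeUpTo (show (α.index j : ℕ) + 1 ≤ α.index i by omega)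
  have : (i : ℕ) ≤ j := h
  omega

theorem fin_covBy_iff {n : ℕ} (i j : Fin n) : i ⋖ j ↔ (i : ℕ) + 1 = j := by
  rw [Fin.covBy_iff, Nat.covBy_iff_add_one_eq]

/-- Sorting key for `wordPerm`. -/
def wordKey {n : ℕ} (α : Composition n) (j : Fin n) : ℕ := (n - (α.index j : ℕ)) * n + j

/-- A permutation `w_α` of `[n]` with descent composition `α`, see `descents_wordPerm`:
the word that increases along each block of `α` and uses smaller letters in later blocks. -/
def wordPerm {n : ℕ} (α : Composition n) : Equiv.Perm (Fin n) := (Tuple.sort (wordKey α)).symm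

/-- The descent set `Des(w) = {j ∈ [n-1] : w_j > w_{j+1}}` of a permutation (positions counted
from `1`; the letter `w_j` is `w ⟨j - 1, _⟩`). -/
def descents {n : ℕ} (w : Equiv.Perm (Fin n)) : Finset ℕ :=
  (Finset.univ.filter fun j : Fin n => ∃ i : Fin n, (i : ℕ) + 1 = j ∧ w j < w i).image Fin.val

theorem wordPerm_lt_iff {n : ℕ} (α : Composition n) (i j : Fin n) :
    wordPerm α i < wordPerm α j ↔ wordKey α i < wordKey α j := by
  have hinj : Function.Injective (wordKey α) := by
    intro a b h
    have h1 := congrArg (· % n) h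
    simp only [wordKey, Nat.mul_add_mod_self_right] at h1
    rw [Nat.mod_eq_of_lt a.isLt, Nat.mod_eq_of_lt b.isLt] at h1
    exact Fin.ext h1
  have hs : StrictMono (wordKey α ∘ Tuple.sort (wordKey α)) :=
    (Tuple.monotone_sort _).strictMono_of_injective
      (hinj.comp (Tuple.sort (wordKey α)).injective)
  have := hs.lt_iff_lt (a := wordPerm α i) (b := wordPerm α j)
  rw [← this]
  simp [wordPerm]

theorem wordPerm_lt_iff_mem {n : ℕ} (α : Composition n) (i j : Fin n) (h : (i : ℕ) + 1 = j) :
    wordPerm α j < wordPerm α i ↔ (j : ℕ) ∈ partialSums α := by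
  rw [wordPerm_lt_iff, ← index_lt_iff α i j h, wordKey, wordKey]
  have hle := index_mono α i j (Fin.le_def.2 (by omega))
  have hj := j.isLt
  have hk : (α.index j : ℕ) < n := (α.index j).isLt.trans_le α.length_le
  constructor
  · intro hlt
    by_contra hc
    have : (α.index i : ℕ) = α.index j := by omega
    rw [this] at hlt; omega
  · intro hlt
    have h1 : (n - (α.index j : ℕ)) + 1 ≤ n - (α.index i : ℕ) := by omega
    have h2 := Nat.mul_le_mul_right n h1
    rw [add_mul] at h2
    omega

theorem descents_wordPerm {n : ℕ} (α : Composition n) : descents (wordPerm α) = partialSums α := by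
  ext x
  simp only [descents, mem_image, mem_filter, mem_univ, true_and]
  constructor
  · rintro ⟨j, ⟨i, hi, hlt⟩, rfl⟩
    exact (wordPerm_lt_iff_mem α i j hi).1 hlt
  · intro hx
    have h1 := mem_Ico.1 (partialSums_subset α hx)
    exact ⟨⟨x, h1.2⟩, ⟨⟨x - 1, by omega⟩, by simp; omega,
      (wordPerm_lt_iff_mem α _ _ (by simp; omega)).2 hx⟩, rfl⟩

/-! ### `(P, θ)`-partitions and their generating functions -/

section Posets

variable {P : Type*} [PartialOrder P] {n : ℕ}

/-- `(P, θ)`-partitions. -/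
def IsPartition (θ : P ≃ Fin n) (σ : P → ℕ+) : Prop :=
  ∀ s t : P, s ⋖ t → (θ s < θ t → σ s ≤ σ t) ∧ (θ t < θ s → σ s < σ t)

/-- `(P, θ)`-set-valued partitions: every value is a nonempty finite set of positive integers, and
for `s ⋖ t` one has `max (σ s) ≤ min (σ t)` if `θ s < θ t`, and `max (σ s) < min (σ t)` if
`θ s > θ t`. -/
def IsSetPartition (θ : P ≃ Fin n) (σ : P → Finset ℕ+) : Prop :=
  (∀ p, (σ p).Nonempty) ∧
  ∀ s t : P, s ⋖ t →
    (θ s < θ t → ∀ a ∈ σ s, ∀ b ∈ σ t, a ≤ b) ∧ (θ t < θ s → ∀ a ∈ σ s, ∀ b ∈ σ t, a < b)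

/-- `(P, θ)`-multiset-valued partitions: as above with nonempty finite multisets. -/
def IsMultisetPartition (θ : P ≃ Fin n) (σ : P → Multiset ℕ+) : Prop :=
  (∀ p, σ p ≠ 0) ∧
  ∀ s t : P, s ⋖ t →
    (θ s < θ t → ∀ a ∈ σ s, ∀ b ∈ σ t, a ≤ b) ∧ (θ t < θ s → ∀ a ∈ σ s, ∀ b ∈ σ t, a < b)

variable [Fintype P]

/-- The generating function `∑ σ, ∏ i, x_i ^ #σ⁻¹(i)` of the `(P, θ)`-partitions: the coefficient
of `x^m` is the (finite) number of those `σ` whose monomial is `x^m`. -/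
def K (θ : P ≃ Fin n) : MvPowerSeries ℕ+ ℤ := fun m =>
  (Nat.card {σ : P → ℕ+ // IsPartition θ σ ∧ ∑ p, Finsupp.single (σ p) 1 = m} : ℤ)

/-- The generating function of the `(P, θ)`-set-valued partitions; the exponent of `x_i` in the
monomial of `σ` is the number of `p` with `i ∈ σ p`. -/
def Ktilde (θ : P ≃ Fin n) : MvPowerSeries ℕ+ ℤ := fun m =>
  (Nat.card {σ : P → Finset ℕ+ //
    IsSetPartition θ σ ∧ ∑ p, Multiset.toFinsupp (σ p).val = m} : ℤ)

/-- The generating function of the `(P, θ)`-multiset-valued partitions; the exponent of `x_i` in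
the monomial of `σ` is the total number of occurrences of `i` in the multisets `σ p`. -/
def Khat (θ : P ≃ Fin n) : MvPowerSeries ℕ+ ℤ := fun m =>
  (Nat.card {σ : P → Multiset ℕ+ //
    IsMultisetPartition θ σ ∧ ∑ p, Multiset.toFinsupp (σ p) = m} : ℤ)

end Posets

/-- The fundamental quasisymmetric function `L_α`: the chain with `n` elements labeled by `w_α`. -/
def L {n : ℕ} (α : Composition n) : MvPowerSeries ℕ+ ℤ := K (wordPerm α)

/-- The multi-fundamental quasisymmetric function `L̃_α`. -/
def Ltilde {n : ℕ} (α : Composition n) : MvPowerSeries ℕ+ ℤ := Ktilde (wordPerm α)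

/-- The multiset analogue `L̂_α`. -/
def Lhat {n : ℕ} (α : Composition n) : MvPowerSeries ℕ+ ℤ := Khat (wordPerm α)

/-! ### Infinite linear combinations and `𝔪QSym` -/

/-- The degree filtration: power series all of whose monomials have degree at least `N`. -/
def degFiltration (N : ℕ) : Submodule ℤ (MvPowerSeries ℕ+ ℤ) where
  carrier := {f | ∀ m : ℕ+ →₀ ℕ, m.degree < N → MvPowerSeries.coeff m f = 0}
  zero_mem' := by simp
  add_mem' := by
    intro f g hf hg m hm
    rw [map_add, hf m hm, hg m hm, add_zero]
  smul_mem' := by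
    intro c f hf m hm
    rw [map_smul, hf m hm, smul_zero]

/-- `f = ∑ i, c i • b i`, an arbitrary (possibly infinite) linear combination, the sum converging
in the topology induced by the degree filtration. -/
def IsLinComb {ι : Type*} (b : ι → MvPowerSeries ℕ+ ℤ) (c : ι → ℤ) (f : MvPowerSeries ℕ+ ℤ) :
    Prop :=
  ∀ N : ℕ, ∀ᶠ s : Finset ι in Filter.atTop, f - ∑ i ∈ s, c i • b i ∈ degFiltration N

/-- The set of all infinite linear combinations of the family `b`. -/
def continuousSpan {ι : Type*} (b : ι → MvPowerSeries ℕ+ ℤ) :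
    Submodule ℤ (MvPowerSeries ℕ+ ℤ) where
  carrier := {f | ∃ c, IsLinComb b c f}
  zero_mem' := ⟨0, fun N => by simp⟩
  add_mem' := by
    rintro f g ⟨c, hc⟩ ⟨d, hd⟩
    refine ⟨c + d, fun N => ?_⟩
    filter_upwards [hc N, hd N] with s h1 h2
    have := add_mem h1 h2
    convert this using 1
    simp only [Pi.add_apply, add_smul, Finset.sum_add_distrib]
    abel
  smul_mem' := by
    rintro r f ⟨c, hc⟩
    refine ⟨r • c, fun N => ?_⟩
    filter_upwards [hc N] with s h1
    have := Submodule.smul_mem _ r h1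
    convert this using 1
    simp only [Pi.smul_apply, smul_sub, Finset.smul_sum, smul_assoc]

/-- `b` is a continuous basis of `M`: arbitrary linear combinations of `b` converge to elements of
`M`, and every element of `M` is such a combination in exactly one way. -/
def IsContinuousBasis {ι : Type*} (M : Submodule ℤ (MvPowerSeries ℕ+ ℤ))
    (b : ι → MvPowerSeries ℕ+ ℤ) : Prop :=
  (∀ c : ι → ℤ, ∃ f ∈ M, IsLinComb b c f) ∧ ∀ f ∈ M, ∃! c : ι → ℤ, IsLinComb b c f

/-- The multi-quasisymmetric functions `𝔪QSym = ∏_α ℤ L̃_α`. -/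
def mQSym : Submodule ℤ (MvPowerSeries ℕ+ ℤ) :=
  continuousSpan fun α : Σ n, Composition n => Ltilde α.2

/-! ### The involution `ω` -/

/-- The exponent of the monomial `x^β = x_1^{β_1} x_2^{β_2} ⋯ x_k^{β_k}`. -/
def expo {n : ℕ} (β : Composition n) : ℕ+ →₀ ℕ :=
  ∑ i : Fin β.length, Finsupp.single (Nat.succPNat i) (β.blocksFun i)

/-- The coefficient of `L_α` in the expansion of a quasisymmetric `f` in fundamental quasisymmetric
functions, obtained by inclusion-exclusion from the coefficients of the monomials `x^β`; see
`lcoeff_L`. -/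
def lcoeff {n : ℕ} (α : Composition n) (f : MvPowerSeries ℕ+ ℤ) : ℤ :=
  ∑ β : Composition n with partialSums β ⊆ partialSums α,
    (-1) ^ (partialSums α \ partialSums β).card * MvPowerSeries.coeff (expo β) f

theorem lcoeff_add {n : ℕ} (α : Composition n) (f g : MvPowerSeries ℕ+ ℤ) :
    lcoeff α (f + g) = lcoeff α f + lcoeff α g := by
  simp only [lcoeff, map_add, mul_add, Finset.sum_add_distrib]

theorem lcoeff_smul {n : ℕ} (α : Composition n) (r : ℤ) (f : MvPowerSeries ℕ+ ℤ) :
    lcoeff α (r • f) = r * lcoeff α f := by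
  simp only [lcoeff, map_zsmul, smul_eq_mul, mul_left_comm _ r, Finset.mul_sum]

/-- The involution `ω`: in each degree it sends `∑ α, c_α L_α` to `∑ α, c_α L_{ω(α)}`. It is the
linear map continuous for the degree filtration with `ω(L_α) = L_{ω(α)}`; see `omega_L` and
`omega_isLinComb`. -/
def omega : MvPowerSeries ℕ+ ℤ →ₗ[ℤ] MvPowerSeries ℕ+ ℤ where
  toFun f := fun m =>
    ∑ α : Composition m.degree, lcoeff α f * MvPowerSeries.coeff m (L (omegaComp α))
  map_add' f g := by
    funext m
    simp only [lcoeff_add, add_mul, Finset.sum_add_distrib]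
    rfl
  map_smul' r f := by
    funext m
    simp only [lcoeff_smul, mul_assoc, ← Finset.mul_sum]
    rfl

theorem coeff_omega (f : MvPowerSeries ℕ+ ℤ) (m : ℕ+ →₀ ℕ) :
    MvPowerSeries.coeff m (omega f) =
      ∑ α : Composition m.degree, lcoeff α f * MvPowerSeries.coeff m (L (omegaComp α)) := rfl

theorem expo_eq {n : ℕ} (β : Composition n) :
    expo β = ∑ j : Fin n, Finsupp.single (Nat.succPNat (β.index j)) 1 := by
  rw [← β.blocksFinEquiv.sum_comp, Fintype.sum_sigma, expo]
  refine Finset.sum_congr rfl fun i _ => ?_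
  have : ∀ y, β.index (β.blocksFinEquiv ⟨i, y⟩) = i := fun y => β.index_embedding i y
  simp [this]

theorem degree_sum_single {n : ℕ} (σ : Fin n → ℕ+) :
    (∑ p, Finsupp.single (σ p) 1 : ℕ+ →₀ ℕ).degree = n := by
  rw [map_sum]; simp [Finsupp.degree_single]

theorem degree_expo {n : ℕ} (β : Composition n) : (expo β).degree = n := by
  rw [expo_eq, degree_sum_single]

theorem coeff_L_of_ne {n : ℕ} (α : Composition n) (m : ℕ+ →₀ ℕ) (h : m.degree ≠ n) :
    MvPowerSeries.coeff m (L α) = 0 := by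
  change (Nat.card {σ : Fin n → ℕ+ // _} : ℤ) = 0
  have : IsEmpty {σ : Fin n → ℕ+ //
      IsPartition (wordPerm α) σ ∧ ∑ p, Finsupp.single (σ p) 1 = m} :=
    ⟨fun σ => h (by rw [← σ.2.2, degree_sum_single])⟩
  simp

theorem monotone_unique {n : ℕ} (σ τ : Fin n → ℕ+) (hσ : Monotone σ) (hτ : Monotone τ)
    (h : (∑ p, Finsupp.single (σ p) 1 : ℕ+ →₀ ℕ) = ∑ p, Finsupp.single (τ p) 1) : σ = τ := by
  have key : ∀ ρ : Fin n → ℕ+, (∑ p, Finsupp.single (ρ p) 1 : ℕ+ →₀ ℕ) =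
      Multiset.toFinsupp (List.ofFn ρ : Multiset ℕ+) := by
    intro ρ
    ext a
    rw [Multiset.toFinsupp_apply, ← Fin.univ_val_map, Multiset.count_map]
    simp [Finsupp.finsetSum_apply, Finsupp.single_apply, Finset.sum_boole, eq_comm,
      Finset.card_def]
  rw [key, key] at h
  have h2 : (List.ofFn σ).Perm (List.ofFn τ) :=
    Multiset.coe_eq_coe.1 (Multiset.toFinsupp.injective h)
  exact List.ofFn_injective (h2.eq_of_pairwise' hσ.sortedLE_ofFn.pairwise
    hτ.sortedLE_ofFn.pairwise)

theorem coeff_expo_L {n : ℕ} (α β : Composition n) :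
    MvPowerSeries.coeff (expo β) (L α) = if partialSums α ⊆ partialSums β then 1 else 0 := by
  change (Nat.card {σ : Fin n → ℕ+ // _} : ℤ) = _
  set w : Fin n → ℕ+ := fun j => Nat.succPNat (β.index j) with hw
  have hwm : Monotone w := fun i j h => Nat.succPNat_le_succPNat.2 (index_mono β i j h)
  have huniq : ∀ σ : Fin n → ℕ+,
      IsPartition (wordPerm α) σ → ∑ p, Finsupp.single (σ p) 1 = expo β → σ = w := by
    intro σ h1 h2
    refine monotone_unique σ w ?_ hwm (by rw [h2, expo_eq])
    cases n with
    | zero => exact fun i => i.elim0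
    | succ k =>
      rw [Fin.monotone_iff_le_succ]
      intro i
      have hc : i.castSucc ⋖ i.succ := (fin_covBy_iff _ _).2 (by simp)
      rcases lt_trichotomy (wordPerm α i.castSucc) (wordPerm α i.succ) with h | h | h
      · exact (h1 _ _ hc).1 h
      · exact absurd ((wordPerm α).injective h) hc.lt.ne
      · exact ((h1 _ _ hc).2 h).le
  split_ifs with hsub
  · have hwP : IsPartition (wordPerm α) w ∧ ∑ p, Finsupp.single (w p) 1 = expo β := by
      refine ⟨fun s t hst => ⟨fun _ => hwm hst.le, fun hlt => ?_⟩, (expo_eq β).symm⟩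
      have h := (fin_covBy_iff _ _).1 hst
      exact Nat.succPNat_lt_succPNat.2
        ((index_lt_iff β s t h).2 (hsub ((wordPerm_lt_iff_mem α s t h).1 hlt)))
    have : Nat.card {σ : Fin n → ℕ+ //
        IsPartition (wordPerm α) σ ∧ ∑ p, Finsupp.single (σ p) 1 = expo β} = 1 :=
      Nat.card_eq_one_iff_exists.2 ⟨⟨w, hwP⟩, fun σ => Subtype.ext (huniq _ σ.2.1 σ.2.2)⟩
    rw [this]; rfl
  · have : IsEmpty {σ : Fin n → ℕ+ //
        IsPartition (wordPerm α) σ ∧ ∑ p, Finsupp.single (σ p) 1 = expo β} := by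
      refine ⟨fun σ => hsub fun x hx => ?_⟩
      have hσ := huniq _ σ.2.1 σ.2.2
      have h1 := mem_Ico.1 (partialSums_subset α hx)
      have hij : ((⟨x - 1, by omega⟩ : Fin n) : ℕ) + 1 = (⟨x, h1.2⟩ : Fin n) := by simp; omega
      have hlt := (σ.2.1 _ _ ((fin_covBy_iff _ _).2 hij)).2 ((wordPerm_lt_iff_mem α _ _ hij).2 hx)
      rw [hσ] at hlt
      exact (index_lt_iff β _ _ hij).1 (Nat.succPNat_lt_succPNat.1 hlt)
    simp

/-- The functionals `lcoeff` are dual to the fundamental quasisymmetric functions. -/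
theorem lcoeff_L {n : ℕ} (α γ : Composition n) : lcoeff γ (L α) = if γ = α then 1 else 0 := by
  simp only [lcoeff, coeff_expo_L, mul_ite, mul_one, mul_zero]
  have h1 : ∑ β : Composition n with partialSums β ⊆ partialSums γ,
      (if partialSums α ⊆ partialSums β then
        (-1 : ℤ) ^ (partialSums γ \ partialSums β).card else 0) =
      ∑ T ∈ (partialSums γ).powerset,
        if partialSums α ⊆ T then (-1 : ℤ) ^ (partialSums γ \ T).card else 0 := by
    refine Finset.sum_bij (fun β _ => partialSums β) ?_ ?_ ?_ ?_
    · intro β hβ; simpa using hβ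
    · intro β _ β' _ h; exact partialSums_injective h
    · intro T hT
      have hT' := mem_powerset.1 hT
      have h := partialSums_compOfSet (hT'.trans (partialSums_subset γ))
      exact ⟨compOfSet n T, by simpa [h] using hT', h⟩
    · intro β _; rfl
  rw [h1, ← Finset.sum_filter]
  by_cases hsub : partialSums α ⊆ partialSums γ
  · have h2 : ∑ T ∈ (partialSums γ).powerset with partialSums α ⊆ T,
        (-1 : ℤ) ^ (partialSums γ \ T).card =
        ∑ U ∈ (partialSums γ \ partialSums α).powerset, (-1 : ℤ) ^ U.card := by
      refine Finset.sum_bij' (fun T _ => partialSums γ \ T) (fun U _ => partialSums γ \ U)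
        ?_ ?_ ?_ ?_ ?_
      · intro T hT
        simp only [mem_filter, mem_powerset] at hT ⊢
        exact sdiff_subset_sdiff le_rfl hT.2
      · intro U hU
        simp only [mem_filter, mem_powerset] at hU ⊢
        refine ⟨sdiff_subset, fun x hx => mem_sdiff.2 ⟨hsub hx, fun hxU => ?_⟩⟩
        exact (mem_sdiff.1 (hU hxU)).2 hx
      · intro T hT
        simp only [mem_filter, mem_powerset] at hT
        exact Finset.sdiff_sdiff_eq_self hT.1
      · intro U hU
        exact Finset.sdiff_sdiff_eq_self ((mem_powerset.1 hU).trans sdiff_subset)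
      · intro T _; rfl
    rw [h2, Finset.sum_powerset_neg_one_pow_card]
    have : partialSums γ \ partialSums α = ∅ ↔ γ = α := by
      rw [sdiff_eq_empty_iff_subset]
      exact ⟨fun h => partialSums_injective (h.antisymm hsub), fun h => by rw [h]⟩
    simp only [this]
  · rw [if_neg (fun h => hsub (by rw [h])), Finset.filter_false_of_mem, Finset.sum_empty]
    intro T hT h
    exact hsub (h.trans (mem_powerset.1 hT))

/-- `ω(L_α) = L_{ω(α)}`. -/
theorem omega_L {n : ℕ} (α : Composition n) : omega (L α) = L (omegaComp α) := by
  ext m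
  rw [coeff_omega]
  by_cases h : m.degree = n
  · subst h
    simp [lcoeff_L]
  · rw [coeff_L_of_ne _ _ h]
    refine Finset.sum_eq_zero fun γ _ => ?_
    have : lcoeff γ (L α) = 0 := by
      simp only [lcoeff]
      refine Finset.sum_eq_zero fun β _ => ?_
      rw [coeff_L_of_ne α _ (by rwa [degree_expo]), mul_zero]
    rw [this, zero_mul]

/-- `ω` respects arbitrary linear combinations. -/
theorem omega_isLinComb {ι : Type*} {b : ι → MvPowerSeries ℕ+ ℤ} {c : ι → ℤ}
    {f : MvPowerSeries ℕ+ ℤ} (h : IsLinComb b c f) :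
    IsLinComb (fun i => omega (b i)) c (omega f) := by
  intro N
  filter_upwards [h N] with s hs
  have : omega f - ∑ i ∈ s, c i • omega (b i) = omega (f - ∑ i ∈ s, c i • b i) := by
    rw [map_sub, map_sum]; simp only [map_smul]
  rw [this]
  intro m hm
  rw [coeff_omega]
  refine Finset.sum_eq_zero fun γ _ => ?_
  have h0 : lcoeff γ (f - ∑ i ∈ s, c i • b i) = 0 := by
    simp only [lcoeff]
    refine Finset.sum_eq_zero fun β _ => ?_
    rw [hs _ (by rwa [degree_expo]), mul_zero]
  rw [h0, zero_mul]

end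

end MQSym

namespace MQSym

open Finset

/-! ### Monotone surjections and concatenation of cells -/

/-- Weakly increasing words whose steps at the positions in `S` are strict. -/
def IsWord {N : ℕ} (S : Finset ℕ) (a : Fin N → ℕ+) : Prop :=
  ∀ s t : Fin N, s ⋖ t → a s ≤ a t ∧ ((t : ℕ) ∈ S → a s < a t)

/-- Chains of nonempty multisets, weakly increasing and strictly so at the positions in `S`;
the cells are sets if `B = true`. -/
def IsCellPartition {n : ℕ} (B : Bool) (S : Finset ℕ) (σ : Fin n → Multiset ℕ+) : Prop :=
  (∀ p, σ p ≠ 0) ∧ (B = true → ∀ p, (σ p).Nodup) ∧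
  ∀ s t : Fin n, s ⋖ t → ∀ a ∈ σ s, ∀ b ∈ σ t, a ≤ b ∧ ((t : ℕ) ∈ S → a < b)

/-- The weakly increasing surjections of chains. -/
def MonoSurj (N n : ℕ) : Type := {t : Fin N → Fin n // Monotone t ∧ Function.Surjective t}

noncomputable instance (N n : ℕ) : Fintype (MonoSurj N n) := by
  classical exact Subtype.fintype _

/-- The positions where the concatenation of the cells indexed by the fibres of `t` has to be
strict. -/
def refineSet {N n : ℕ} (B : Bool) (S : Finset ℕ) (t : Fin N → Fin n) : Finset ℕ :=
  (Finset.univ.filter fun j : Fin N => ∃ i : Fin N, (i : ℕ) + 1 = j ∧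
    (t i = t j ∧ B = true ∨ t i ≠ t j ∧ (t j : ℕ) ∈ S)).image Fin.val

theorem mem_refineSet {N n : ℕ} {B : Bool} {S : Finset ℕ} {t : Fin N → Fin n} {i j : Fin N}
    (h : (i : ℕ) + 1 = j) : (j : ℕ) ∈ refineSet B S t ↔
      (t i = t j ∧ B = true ∨ t i ≠ t j ∧ (t j : ℕ) ∈ S) := by
  simp only [refineSet, mem_image, mem_filter, mem_univ, true_and]
  constructor
  · rintro ⟨j', ⟨i', h1, h2⟩, h3⟩
    obtain rfl : j' = j := Fin.ext h3
    obtain rfl : i' = i := Fin.ext (by omega)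
    exact h2
  · exact fun h2 => ⟨j, ⟨i, h, h2⟩, rfl⟩

theorem refineSet_subset {N n : ℕ} (B : Bool) (S : Finset ℕ) (t : Fin N → Fin n) :
    refineSet B S t ⊆ Finset.Ico 1 N := by
  intro x hx
  simp only [refineSet, mem_image, mem_filter, mem_univ, true_and] at hx
  obtain ⟨j, ⟨i, h, -⟩, rfl⟩ := hx
  simp only [mem_Ico]
  omega

theorem IsWord.monotone {N : ℕ} {S : Finset ℕ} {a : Fin N → ℕ+} (h : IsWord S a) :
    Monotone a := by
  cases N with
  | zero => exact fun i => i.elim0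
  | succ k =>
    rw [Fin.monotone_iff_le_succ]
    exact fun i => (h _ _ ((fin_covBy_iff _ _).2 (by simp))).1

theorem toFinsupp_map {ι : Type*} (s : Finset ι) (a : ι → ℕ+) :
    Multiset.toFinsupp (s.val.map a) = ∑ i ∈ s, Finsupp.single (a i) 1 := by
  classical
  induction s using Finset.induction_on with
  | empty => simp
  | insert i s hi ih =>
    rw [Finset.insert_val_of_notMem hi, Multiset.map_cons, ← Multiset.singleton_add, map_add, ih,
      Finset.sum_insert hi, Multiset.toFinsupp_singleton]

theorem degree_toFinsupp (s : Multiset ℕ+) : (Multiset.toFinsupp s).degree = s.card := by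
  induction s using Multiset.induction_on with
  | empty => simp
  | cons a s ih =>
    rw [← Multiset.singleton_add, map_add, map_add, ih, Multiset.toFinsupp_singleton,
      Finsupp.degree_single]
    simp [add_comm]

theorem monotone_eq_of_card_fiber {N n : ℕ} {t u : Fin N → Fin n} (ht : Monotone t)
    (hu : Monotone u) (h : ∀ j, (univ.filter (t · = j)).card = (univ.filter (u · = j)).card) :
    t = u := by
  have key : ∀ v : Fin N → Fin n, (∑ p, Finsupp.single (Nat.succPNat (v p)) 1 : ℕ+ →₀ ℕ) =
      ∑ j : Fin n, (univ.filter (v · = j)).card • Finsupp.single (Nat.succPNat j) 1 := by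
    intro v
    rw [← Finset.sum_fiberwise univ v]
    refine Finset.sum_congr rfl fun j _ => ?_
    rw [← Finset.sum_const]
    refine Finset.sum_congr rfl fun p hp => ?_
    rw [(mem_filter.1 hp).2]
  have h1 := monotone_unique (fun p => Nat.succPNat (t p)) (fun p => Nat.succPNat (u p))
    (fun i j hij => Nat.succPNat_le_succPNat.2 (ht hij))
    (fun i j hij => Nat.succPNat_le_succPNat.2 (hu hij))
    (by rw [key, key]; simp only [h])
  funext p
  exact Fin.ext (Nat.succPNat_injective (congrFun h1 p))

theorem covBy_of_monotone_surjective {N n : ℕ} {t : Fin N → Fin n} (ht : Monotone t)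
    (hs : Function.Surjective t) {i j : Fin N} (hij : i ⋖ j) (hne : t i ≠ t j) : t i ⋖ t j := by
  refine ⟨lt_of_le_of_ne (ht hij.le) hne, fun c h1 h2 => ?_⟩
  obtain ⟨x, rfl⟩ := hs c
  exact hij.2 (ht.reflect_lt h1) (ht.reflect_lt h2)

/-- Distinct elements `x < y` are separated by a covering pair at the last element of a down-set. -/
theorem exists_covBy_between {N : ℕ} (p : Fin N → Prop) {x y : Fin N} (hxy : x ≤ y) (hx : p x)
    (hy : ¬ p y) : ∃ i j : Fin N, i ⋖ j ∧ x ≤ i ∧ j ≤ y ∧ p i ∧ ¬ p j := by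
  classical
  have hne : (univ.filter fun z : Fin N => x ≤ z ∧ ¬ p z).Nonempty :=
    ⟨y, by simp [hxy, hy]⟩
  set j := (univ.filter fun z : Fin N => x ≤ z ∧ ¬ p z).min' hne with hj
  have hjm := Finset.min'_mem _ hne
  rw [← hj] at hjm
  simp only [mem_filter, mem_univ, true_and] at hjm
  have hjy : j ≤ y := Finset.min'_le _ _ (by simp [hxy, hy])
  have hxj : x < j := lt_of_le_of_ne hjm.1 fun h => hjm.2 (h ▸ hx)
  have hxj' : (x : ℕ) < j := hxj
  refine ⟨⟨j - 1, by omega⟩, j, (fin_covBy_iff _ _).2 (by simp; omega), ?_, hjy, ?_, hjm.2⟩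
  · rw [Fin.le_def]; simp; omega
  · by_contra hc
    have hm : j ≤ ⟨(j : ℕ) - 1, by omega⟩ := by
      refine Finset.min'_le _ _ ?_
      simp only [mem_filter, mem_univ, true_and]
      exact ⟨by rw [Fin.le_def]; simp; omega, hc⟩
    rw [Fin.le_def] at hm
    simp at hm
    omega

/-- The cells cut out of the word `a` by the fibres of `t`. -/
def cells {N n : ℕ} (t : Fin N → Fin n) (a : Fin N → ℕ+) (j : Fin n) : Multiset ℕ+ :=
  (univ.filter (t · = j)).val.map a

theorem mem_cells {N n : ℕ} {t : Fin N → Fin n} {a : Fin N → ℕ+} {j : Fin n} {x : ℕ+} :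
    x ∈ cells t a j ↔ ∃ i, t i = j ∧ a i = x := by
  simp [cells]

theorem sum_toFinsupp_cells {N n : ℕ} (t : Fin N → Fin n) (a : Fin N → ℕ+) :
    ∑ j, Multiset.toFinsupp (cells t a j) = ∑ i, Finsupp.single (a i) 1 := by
  simp only [cells, toFinsupp_map]
  exact Finset.sum_fiberwise univ t _

theorem isCellPartition_cells {N n : ℕ} {B : Bool} {S : Finset ℕ} {t : Fin N → Fin n}
    (ht : Monotone t) (hs : Function.Surjective t) {a : Fin N → ℕ+}
    (ha : IsWord (refineSet B S t) a) : IsCellPartition B S (cells t a) := by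
  have hmono := ha.monotone
  refine ⟨fun p => ?_, fun hB p => ?_, ?_⟩
  · obtain ⟨i, hi⟩ := hs p
    intro h0
    have : a i ∈ cells t a p := mem_cells.2 ⟨i, hi, rfl⟩
    simp [h0] at this
  · have hlt : ∀ i j : Fin N, i < j → t i = p → t j = p → a i < a j := by
      intro i j hij hi hj
      obtain ⟨x, y, hxy, hix, hyj, -, hy⟩ :=
        exists_covBy_between (fun z => z ≤ i) hij.le le_rfl (not_le.2 hij)
      have hx' : t x = t y := le_antisymm (ht hxy.le)
        ((ht hyj).trans (hj.trans hi.symm ▸ ht hix))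
      exact (hmono hix).trans_lt ((((ha x y hxy).2
        ((mem_refineSet ((fin_covBy_iff _ _).1 hxy)).2 (Or.inl ⟨hx', hB⟩)))).trans_le (hmono hyj))
    refine Multiset.Nodup.map_on ?_ (Finset.nodup _)
    intro x hx y hy hxy
    simp only [mem_val, mem_filter, mem_univ, true_and] at hx hy
    by_contra hne
    rcases lt_or_gt_of_ne hne with h | h
    · exact (hlt x y h hx hy).ne hxy
    · exact (hlt y x h hy hx).ne' hxy
  · rintro s u hsu _ hx _ hy
    obtain ⟨x, rfl, rfl⟩ := mem_cells.1 hx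
    obtain ⟨y, rfl, rfl⟩ := mem_cells.1 hy
    have hxy : x ≤ y := (ht.reflect_lt hsu.lt).le
    refine ⟨hmono hxy, fun hS => ?_⟩
    obtain ⟨i, j, hij, hxi, hjy, hi, hj⟩ :=
      exists_covBy_between (fun z => t z ≤ t x) hxy le_rfl (not_le.2 hsu.lt)
    have hj' : t j = t y := by
      refine le_antisymm (ht hjy) (not_lt.1 fun hc => hsu.2 (not_le.1 hj) hc)
    have hne : t i ≠ t j := fun h => hj (h ▸ hi)
    exact (hmono hxi).trans_lt (((ha i j hij).2 ((mem_refineSet ((fin_covBy_iff _ _).1 hij)).2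
      (Or.inr ⟨hne, hj' ▸ hS⟩))).trans_le (hmono hjy))

theorem exists_cells_eq {N n : ℕ} {B : Bool} {S : Finset ℕ} {σ : Fin n → Multiset ℕ+}
    (hσ : IsCellPartition B S σ) (hN : ∑ j, (σ j).card = N) :
    ∃ (t : Fin N → Fin n) (a : Fin N → ℕ+), Monotone t ∧ Function.Surjective t ∧
      IsWord (refineSet B S t) a ∧ cells t a = σ := by
  have hcard : Fintype.card (Σₗ j : Fin n, Fin (σ j).card) = N := by
    change Fintype.card (Σ j : Fin n, Fin (σ j).card) = N
    simp [hN]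
  let e : Fin N ≃o Σₗ j : Fin n, Fin (σ j).card := Fintype.orderIsoFinOfCardEq _ hcard
  have hlen : ∀ j, ((σ j).sort (· ≤ ·)).length = (σ j).card := fun j => Multiset.length_sort ..
  let v : (j : Fin n) → Fin (σ j).card → ℕ+ := fun j y =>
    ((σ j).sort (· ≤ ·)).get (y.cast (hlen j).symm)
  have hv : ∀ j, (univ : Finset (Fin (σ j).card)).val.map (v j) = σ j := by
    intro j
    have h1 : List.ofFn (v j) = (σ j).sort (· ≤ ·) := by
      refine List.ext_get (by simp) fun k h1 h2 => ?_
      simp [v]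
    rw [Fin.univ_val_map, h1, Multiset.sort_eq]
  have hvm : ∀ j y, v j y ∈ σ j := fun j y => by
    rw [← Multiset.mem_sort (· ≤ ·)]; exact List.get_mem _ _
  have hvle : ∀ j, Monotone (v j) := by
    intro j x y hxy
    exact ((σ j).pairwise_sort (· ≤ ·)).sortedLE.monotone_get hxy
  have hvlt : B = true → ∀ j, StrictMono (v j) := by
    intro hB j
    refine (hvle j).strictMono_of_injective ?_
    intro x y hxy
    have hnd : ((σ j).sort (· ≤ ·)).Nodup := by
      rw [← Multiset.coe_nodup, Multiset.sort_eq]; exact hσ.2.1 hB j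
    have := hnd.injective_get hxy
    exact Fin.ext (by simpa using congrArg Fin.val this)
  let t : Fin N → Fin n := fun i => (ofLex (e i)).1
  let a : Fin N → ℕ+ := fun i => v _ (ofLex (e i)).2
  have hlex : ∀ i j : Fin N, i < j → t i < t j ∨ ∃ (p : Fin n) (x y : Fin (σ p).card), x < y ∧
      e i = toLex ⟨p, x⟩ ∧ e j = toLex ⟨p, y⟩ := by
    intro i j hij
    have h1 : e i < e j := e.lt_iff_lt.2 hij
    change t i < t j ∨ _
    have h2 : Sigma.Lex (· < ·) (fun _ => (· < ·)) (ofLex (e i)) (ofLex (e j)) := h1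
    generalize hI : ofLex (e i) = I at h2
    generalize hJ : ofLex (e j) = J at h2
    cases h2 with
    | left x y h => left; simpa [t, hI, hJ] using h
    | right x y h => exact Or.inr ⟨_, x, y, h, hI, hJ⟩
  have htm : Monotone t := by
    intro i j hij
    rcases hij.eq_or_lt with rfl | h
    · exact le_rfl
    rcases hlex i j h with h | ⟨p, x, y, -, h1, h2⟩
    · exact h.le
    · simp [t, h1, h2]
  have hts : Function.Surjective t := by
    intro j
    have : 0 < (σ j).card := Multiset.card_pos.2 (hσ.1 j)
    exact ⟨e.symm (toLex ⟨j, ⟨0, this⟩⟩), by simp [t]⟩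
  refine ⟨t, a, htm, hts, ?_, ?_⟩
  · intro i j hij
    rw [mem_refineSet ((fin_covBy_iff _ _).1 hij)]
    rcases hlex i j hij.lt with h | ⟨p, x, y, hxy, h1, h2⟩
    · have := hσ.2.2 (t i) (t j) (covBy_of_monotone_surjective htm hts hij h.ne) (a i) (hvm _ _)
        (a j) (hvm _ _)
      refine ⟨this.1, ?_⟩
      rintro (h' | h')
      · exact absurd h'.1 h.ne
      · exact this.2 h'.2
    · have ht1 : t i = p := by simp [t, h1]
      have ht2 : t j = p := by simp [t, h2]
      have ha1 : a i = v p x := by simp only [a]; rw [h1]; rfl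
      have ha2 : a j = v p y := by simp only [a]; rw [h2]; rfl
      rw [ha1, ha2]
      refine ⟨hvle p hxy.le, ?_⟩
      rintro (h' | h')
      · exact hvlt h'.2 p hxy
      · exact absurd (ht1.trans ht2.symm) h'.1
  · funext j
    let g : Fin (σ j).card → Fin N := fun y => e.symm (toLex ⟨j, y⟩)
    have he : ∀ y, e (g y) = toLex ⟨j, y⟩ := fun y => e.apply_symm_apply _
    have hg : Function.Injective g := fun x y h => by
      have h' := congrArg e h
      rw [he, he] at h'
      simpa using h'
    have hag : ∀ y, a (g y) = v j y := fun y => by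
      simp only [a]; rw [he]; rfl
    have h1 : univ.filter (t · = j) = univ.map ⟨g, hg⟩ := by
      ext i
      simp only [mem_filter, mem_univ, true_and, mem_map]
      constructor
      · rintro rfl
        exact ⟨(ofLex (e i)).2, e.symm_apply_apply i⟩
      · rintro ⟨y, rfl⟩
        change (ofLex (e (g y))).1 = j
        rw [he]
        rfl
    rw [cells, h1, Finset.map_val, Multiset.map_map]
    exact (Multiset.map_congr rfl fun y _ => hag y).trans (hv j)

theorem subsingleton_words {N : ℕ} (S : Finset ℕ) (m : ℕ+ →₀ ℕ) :
    Subsingleton {a : Fin N → ℕ+ // IsWord S a ∧ ∑ p, Finsupp.single (a p) 1 = m} :=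
  ⟨fun a b => Subtype.ext (monotone_unique _ _ a.2.1.monotone b.2.1.monotone
    (a.2.2.trans b.2.2.symm))⟩

theorem card_cellPartitions {n : ℕ} (B : Bool) (S : Finset ℕ) (m : ℕ+ →₀ ℕ) :
    Nat.card {σ : Fin n → Multiset ℕ+ //
      IsCellPartition B S σ ∧ ∑ p, Multiset.toFinsupp (σ p) = m} =
    ∑ t : MonoSurj m.degree n, Nat.card {a : Fin m.degree → ℕ+ //
      IsWord (refineSet B S t.1) a ∧ ∑ p, Finsupp.single (a p) 1 = m} := by
  have hfin := fun t : MonoSurj m.degree n =>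
    (subsingleton_words (N := m.degree) (refineSet B S t.1) m)
  rw [← Nat.card_sigma]
  symm
  refine Nat.card_congr (Equiv.ofBijective (fun x => ⟨cells x.1.1 x.2.1,
    isCellPartition_cells x.1.2.1 x.1.2.2 x.2.2.1,
    by rw [sum_toFinsupp_cells]; exact x.2.2.2⟩) ⟨?_, ?_⟩)
  · rintro ⟨⟨t, ht⟩, a, ha⟩ ⟨⟨u, hu⟩, b, hb⟩ h
    simp only [Subtype.mk.injEq] at h
    have htu : t = u := by
      refine monotone_eq_of_card_fiber ht.1 hu.1 fun j => ?_
      have := congrArg Multiset.card (congrFun h j)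
      simpa only [cells, Multiset.card_map, Finset.card_val] using this
    subst htu
    have hab : a = b := monotone_unique _ _ ha.1.monotone hb.1.monotone (ha.2.trans hb.2.symm)
    subst hab
    rfl
  · rintro ⟨σ, hσ, hm⟩
    have hN : ∑ j, (σ j).card = m.degree := by
      rw [← hm, map_sum]
      exact Finset.sum_congr rfl fun j _ => (degree_toFinsupp _).symm
    obtain ⟨t, a, h1, h2, h3, h4⟩ := exists_cells_eq hσ hN
    refine ⟨⟨⟨t, h1, h2⟩, a, h3, ?_⟩, Subtype.ext h4⟩
    rw [← sum_toFinsupp_cells t a, h4, hm]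

/-! ### Expansion into fundamental quasisymmetric functions -/

theorem mem_partialSums_reverse {n : ℕ} (α : Composition n) {x : ℕ} (hx : x ∈ Finset.Ico 1 n) :
    x ∈ partialSums α.reverse ↔ n - x ∈ partialSums α := by
  have key : ∀ β : Composition n, x ∈ partialSums β.reverse → n - x ∈ partialSums β := by
    intro β h
    simp only [partialSums, mem_image, mem_Ico] at h ⊢
    obtain ⟨i, ⟨h1, h2⟩, h3⟩ := h
    have hl : β.reverse.length = β.length := by simp [Composition.length, Composition.reverse]
    refine ⟨β.length - i, by omega, ?_⟩
    have h4 := β.blocks.sum_take_add_sum_drop (β.length - i)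
    rw [β.blocks_sum] at h4
    have h5 : β.reverse.sizeUpTo i = (β.blocks.drop (β.length - i)).sum := by
      simp only [Composition.sizeUpTo, Composition.reverse, List.take_reverse, List.sum_reverse]
    simp only [Composition.sizeUpTo] at h3 h5 ⊢
    omega
  refine ⟨key α, fun h => ?_⟩
  have hx' := mem_Ico.1 hx
  simp only [partialSums, mem_image, mem_Ico] at h ⊢
  obtain ⟨i, ⟨h1, h2⟩, h3⟩ := h
  have hl : α.reverse.length = α.length := by simp [Composition.length, Composition.reverse]
  refine ⟨α.length - i, by omega, ?_⟩
  have h4 := α.blocks.sum_take_add_sum_drop i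
  rw [α.blocks_sum] at h4
  have h5 : α.reverse.sizeUpTo (α.length - i) = (α.blocks.drop i).sum := by
    simp only [Composition.sizeUpTo, Composition.reverse, List.take_reverse, List.sum_reverse]
    congr 2
    change α.length - (α.length - i) = i
    omega
  simp only [Composition.sizeUpTo] at h3 h5 ⊢
  omega

theorem mem_partialSums_omegaComp {n : ℕ} (α : Composition n) {x : ℕ} :
    x ∈ partialSums (omegaComp α) ↔ x ∈ Finset.Ico 1 n ∧ n - x ∉ partialSums α := by
  rw [omegaComp, partialSums_compOfSet sdiff_subset, mem_sdiff]
  exact and_congr_right fun hx => not_congr (mem_partialSums_reverse α hx)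

theorem omegaComp_omegaComp {n : ℕ} (α : Composition n) : omegaComp (omegaComp α) = α := by
  apply partialSums_injective
  ext x
  rw [mem_partialSums_omegaComp, mem_partialSums_omegaComp]
  constructor
  · rintro ⟨hx, h⟩
    have hx' := mem_Ico.1 hx
    by_contra hc
    exact h ⟨mem_Ico.2 (by omega), by rwa [Nat.sub_sub_self hx'.2.le]⟩
  · intro h
    have hx := partialSums_subset α h
    have hx' := mem_Ico.1 hx
    refine ⟨hx, fun hc => hc.2 ?_⟩
    rwa [Nat.sub_sub_self hx'.2.le]

/-- The generating function of the chains of cells. -/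
noncomputable def cellSeries (n : ℕ) (B : Bool) (S : Finset ℕ) : MvPowerSeries ℕ+ ℤ := fun m =>
  (Nat.card {σ : Fin n → Multiset ℕ+ //
    IsCellPartition B S σ ∧ ∑ p, Multiset.toFinsupp (σ p) = m} : ℤ)

theorem wordPerm_conditions_iff {n : ℕ} (α : Composition n) {s t : Fin n} (h : s ⋖ t)
    {p q : Prop} (hqp : q → p) :
    ((wordPerm α s < wordPerm α t → p) ∧ (wordPerm α t < wordPerm α s → q)) ↔
      (p ∧ ((t : ℕ) ∈ partialSums α → q)) := by
  rw [wordPerm_lt_iff_mem α s t ((fin_covBy_iff _ _).1 h),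
    ← wordPerm_lt_iff_mem α s t ((fin_covBy_iff _ _).1 h)]
  rcases lt_trichotomy (wordPerm α s) (wordPerm α t) with h' | h' | h'
  · simp [h', h'.not_gt]
  · exact absurd ((wordPerm α).injective h') h.lt.ne
  · simp only [h', h'.not_gt]
    tauto

theorem isPartition_wordPerm_iff {n : ℕ} (α : Composition n) (a : Fin n → ℕ+) :
    IsPartition (wordPerm α) a ↔ IsWord (partialSums α) a :=
  forall₂_congr fun _ _ => forall_congr' fun h => wordPerm_conditions_iff α h le_of_lt

theorem isMultisetPartition_wordPerm_iff {n : ℕ} (α : Composition n) (σ : Fin n → Multiset ℕ+) :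
    IsMultisetPartition (wordPerm α) σ ↔ IsCellPartition false (partialSums α) σ := by
  simp only [IsMultisetPartition, IsCellPartition, Bool.false_eq_true, false_implies, true_and]
  refine and_congr_right fun _ => forall₂_congr fun s t => forall_congr' fun h => ?_
  rw [wordPerm_conditions_iff α h fun h' a ha b hb => (h' a ha b hb).le]
  exact ⟨fun h a ha b hb => ⟨h.1 a ha b hb, fun ht => h.2 ht a ha b hb⟩,
    fun h => ⟨fun a ha b hb => (h a ha b hb).1, fun ht a ha b hb => (h a ha b hb).2 ht⟩⟩

theorem isSetPartition_wordPerm_iff {n : ℕ} (α : Composition n) (σ : Fin n → Finset ℕ+) :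
    IsSetPartition (wordPerm α) σ ↔
      IsCellPartition true (partialSums α) fun p => (σ p).val := by
  simp only [IsSetPartition, IsCellPartition, Finset.mem_val, Finset.nodup, implies_true,
    true_and, ne_eq, Finset.val_eq_zero, Finset.nonempty_iff_ne_empty]
  refine and_congr_right fun _ => forall₂_congr fun s t => forall_congr' fun h => ?_
  rw [wordPerm_conditions_iff α h fun h' a ha b hb => (h' a ha b hb).le]
  exact ⟨fun h a ha b hb => ⟨h.1 a ha b hb, fun ht => h.2 ht a ha b hb⟩,
    fun h => ⟨fun a ha b hb => (h a ha b hb).1, fun ht a ha b hb => (h a ha b hb).2 ht⟩⟩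

theorem Lhat_eq {n : ℕ} (α : Composition n) : Lhat α = cellSeries n false (partialSums α) := by
  funext m
  simp only [Lhat, Khat, cellSeries, isMultisetPartition_wordPerm_iff]

theorem Ltilde_eq {n : ℕ} (α : Composition n) : Ltilde α = cellSeries n true (partialSums α) := by
  funext m
  simp only [Ltilde, Ktilde, cellSeries, isSetPartition_wordPerm_iff]
  congr 1
  refine Nat.card_congr (Equiv.ofBijective (fun σ => ⟨fun p => (σ.1 p).val, σ.2⟩) ⟨?_, ?_⟩)
  · rintro ⟨σ, hσ⟩ ⟨τ, hτ⟩ h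
    simp only [Subtype.mk.injEq] at h
    exact Subtype.ext (funext fun p => Finset.val_injective (congrFun h p))
  · rintro ⟨σ, hσ⟩
    exact ⟨⟨fun p => ⟨σ p, hσ.1.2.1 rfl p⟩, hσ⟩, rfl⟩

theorem coeff_cellSeries {n N : ℕ} (B : Bool) (S : Finset ℕ) (m : ℕ+ →₀ ℕ) (hm : m.degree = N) :
    MvPowerSeries.coeff m (cellSeries n B S) =
      MvPowerSeries.coeff m (∑ t : MonoSurj N n, L (compOfSet N (refineSet B S t.1))) := by
  subst hm
  rw [map_sum]
  change (Nat.card {σ : Fin n → Multiset ℕ+ // _} : ℤ) = ∑ t, (Nat.card {a : _ → ℕ+ // _} : ℤ)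
  rw [card_cellPartitions, Nat.cast_sum]
  refine Finset.sum_congr rfl fun t _ => ?_
  simp only [isPartition_wordPerm_iff, partialSums_compOfSet (refineSet_subset B S t.1)]

theorem lcoeff_congr {N : ℕ} {f g : MvPowerSeries ℕ+ ℤ}
    (h : ∀ m : ℕ+ →₀ ℕ, m.degree = N → MvPowerSeries.coeff m f = MvPowerSeries.coeff m g)
    (β : Composition N) : lcoeff β f = lcoeff β g :=
  Finset.sum_congr rfl fun γ _ => by rw [h _ (degree_expo γ)]

theorem coeff_omega_congr {N : ℕ} {f g : MvPowerSeries ℕ+ ℤ}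
    (h : ∀ m : ℕ+ →₀ ℕ, m.degree = N → MvPowerSeries.coeff m f = MvPowerSeries.coeff m g)
    (m : ℕ+ →₀ ℕ) (hm : m.degree = N) :
    MvPowerSeries.coeff m (omega f) = MvPowerSeries.coeff m (omega g) := by
  subst hm
  rw [coeff_omega, coeff_omega]
  exact Finset.sum_congr rfl fun γ _ => by rw [lcoeff_congr h]

/-- Conjugation of a monotone surjection by the reversals of both chains. -/
def MonoSurj.rev {N n : ℕ} (t : MonoSurj N n) : MonoSurj N n :=
  ⟨fun i => (t.1 i.rev).rev, fun _ _ h => Fin.rev_le_rev.2 (t.2.1 (Fin.rev_le_rev.2 h)),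
    fun j => by
      obtain ⟨i, hi⟩ := t.2.2 j.rev
      exact ⟨i.rev, by simp [hi]⟩⟩

theorem MonoSurj.rev_involutive {N n : ℕ} : Function.Involutive (MonoSurj.rev (N := N) (n := n)) :=
  fun t => Subtype.ext (by funext i; simp [MonoSurj.rev])

theorem omegaComp_refine {N n : ℕ} (B : Bool) (α : Composition n) (t : MonoSurj N n) :
    omegaComp (compOfSet N (refineSet B (partialSums α) t.1)) =
      compOfSet N (refineSet (!B) (partialSums (omegaComp α)) t.rev.1) := by
  apply partialSums_injective
  ext x
  rw [mem_partialSums_omegaComp, partialSums_compOfSet (refineSet_subset _ _ _),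
    partialSums_compOfSet (refineSet_subset _ _ _)]
  by_cases hx : x ∈ Finset.Ico 1 N
  swap
  · exact ⟨fun h => absurd h.1 hx, fun h => absurd (refineSet_subset _ _ _ h) hx⟩
  simp only [hx, true_and]
  have hx' := mem_Ico.1 hx
  let j : Fin N := ⟨x, hx'.2⟩
  let i : Fin N := ⟨x - 1, by omega⟩
  have hij : (i : ℕ) + 1 = j := by simp only [i, j]; omega
  have hrev : (j.rev : ℕ) + 1 = i.rev := by simp only [Fin.val_rev]; omega
  have hNx : N - x = (i.rev : ℕ) := by simp only [Fin.val_rev, i]; omega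
  have hxj : x = (j : ℕ) := rfl
  rw [hNx, mem_refineSet hrev, hxj, mem_refineSet hij, mem_partialSums_omegaComp]
  simp only [MonoSurj.rev, Fin.rev_inj]
  by_cases heq : t.1 j.rev = t.1 i.rev
  · simp [heq]
  · have hc := covBy_of_monotone_surjective t.2.1 t.2.2 ((fin_covBy_iff _ _).2 hrev) heq
    have hc' := (fin_covBy_iff _ _).1 hc
    have h1 : ((t.1 j.rev).rev : ℕ) ∈ Finset.Ico 1 n := by
      rw [mem_Ico, Fin.val_rev]; omega
    have h2 : n - ((t.1 j.rev).rev : ℕ) = t.1 i.rev := by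
      rw [Fin.val_rev]; omega
    rw [h2]
    simp only [h1, heq, Ne.symm heq, Fin.rev_inj, true_and, false_and, false_or, ne_eq,
      not_false_eq_true]

theorem omega_cellSeries {n : ℕ} (B : Bool) (α : Composition n) :
    omega (cellSeries n B (partialSums α)) = cellSeries n (!B) (partialSums (omegaComp α)) := by
  ext m
  rw [coeff_omega_congr (coeff_cellSeries B (partialSums α)) m rfl,
    coeff_cellSeries _ _ m rfl, map_sum, map_sum, map_sum]
  simp only [omega_L, omegaComp_refine]
  exact Equiv.sum_comp MonoSurj.rev_involutive.toPerm fun t : MonoSurj m.degree n =>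
    MvPowerSeries.coeff m (L (compOfSet _ (refineSet (!B) (partialSums (omegaComp α)) t.1)))

theorem omega_omega_cellSeries {n : ℕ} (B : Bool) (α : Composition n) :
    omega (omega (cellSeries n B (partialSums α))) = cellSeries n B (partialSums α) := by
  rw [omega_cellSeries, omega_cellSeries, omegaComp_omegaComp, Bool.not_not]

theorem cellSeries_mem_degFiltration (n : ℕ) (B : Bool) (S : Finset ℕ) :
    cellSeries n B S ∈ degFiltration n := by
  intro m hm
  rw [coeff_cellSeries B S m rfl]
  have : IsEmpty (MonoSurj m.degree n) := ⟨fun t => by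
    have := Fintype.card_le_of_surjective _ t.2.2
    simp only [Fintype.card_fin] at this
    omega⟩
  simp

theorem MonoSurj.eq_id {n : ℕ} (t : MonoSurj n n) : t.1 = id := by
  have hi : Function.Injective t.1 := Finite.injective_iff_surjective.2 t.2.2
  have := t.2.1.strictMono_of_injective hi
  exact congrArg DFunLike.coe (Subsingleton.elim
    (StrictMono.orderIsoOfSurjective t.1 this t.2.2) (OrderIso.refl (Fin n)))

theorem refineSet_id {n : ℕ} (B : Bool) (α : Composition n) :
    refineSet B (partialSums α) (id : Fin n → Fin n) = partialSums α := by
  ext x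
  by_cases hx : x ∈ Finset.Ico 1 n
  swap
  · exact ⟨fun h => absurd (refineSet_subset _ _ _ h) hx,
      fun h => absurd (partialSums_subset _ h) hx⟩
  have hx' := mem_Ico.1 hx
  have hij : ((⟨x - 1, by omega⟩ : Fin n) : ℕ) + 1 = (⟨x, hx'.2⟩ : Fin n) := by simp; omega
  have hne : (⟨x - 1, by omega⟩ : Fin n) ≠ ⟨x, hx'.2⟩ := by simp; omega
  have := mem_refineSet (B := B) (S := partialSums α) (t := id) hij
  rw [id, id] at this
  simpa [hne] using this

theorem lcoeff_cellSeries {n : ℕ} (B : Bool) (α β : Composition n) :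
    lcoeff β (cellSeries n B (partialSums α)) = if β = α then 1 else 0 := by
  rw [lcoeff_congr (coeff_cellSeries B (partialSums α)) β, ← lcoeff_L]
  have hu : ∀ t : MonoSurj n n, t = ⟨id, monotone_id, Function.surjective_id⟩ :=
    fun t => Subtype.ext t.eq_id
  let u : Unique (MonoSurj n n) := ⟨⟨⟨id, monotone_id, Function.surjective_id⟩⟩, hu⟩
  rw [Fintype.sum_eq_single _ fun t ht => absurd (hu t) ht]
  simp only [refineSet_id]
  congr 2
  exact partialSums_injective (partialSums_compOfSet (partialSums_subset α))

/-! ### Continuous bases of the fixed space of `ω²` -/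

/-- The series fixed by `ω²`, which are the quasisymmetric ones. -/
noncomputable def omegaFixed : Submodule ℤ (MvPowerSeries ℕ+ ℤ) :=
  LinearMap.eqLocus (omega ∘ₗ omega) LinearMap.id

theorem mem_omegaFixed {f : MvPowerSeries ℕ+ ℤ} : f ∈ omegaFixed ↔ omega (omega f) = f := Iff.rfl

theorem IsLinComb.unique {ι : Type*} {b : ι → MvPowerSeries ℕ+ ℤ} {c : ι → ℤ}
    {f g : MvPowerSeries ℕ+ ℤ} (hf : IsLinComb b c f) (hg : IsLinComb b c g) : f = g := by
  ext m
  obtain ⟨s, h1, h2⟩ := ((hf (m.degree + 1)).and (hg (m.degree + 1))).exists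
  have := sub_mem h1 h2 m (Nat.lt_succ_self _)
  rw [sub_sub_sub_cancel_right, map_sub] at this
  exact sub_eq_zero.1 this

theorem IsLinComb.mem_omegaFixed {ι : Type*} {b : ι → MvPowerSeries ℕ+ ℤ} {c : ι → ℤ}
    {f : MvPowerSeries ℕ+ ℤ} (h : IsLinComb b c f) (hb : ∀ i, b i ∈ omegaFixed) :
    f ∈ omegaFixed := by
  have h2 := omega_isLinComb (omega_isLinComb h)
  simp only [fun i => MQSym.mem_omegaFixed.1 (hb i)] at h2
  exact h2.unique h

theorem eq_of_lcoeff_eq {f g : MvPowerSeries ℕ+ ℤ} (hf : f ∈ omegaFixed) (hg : g ∈ omegaFixed)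
    (h : ∀ (n : ℕ) (β : Composition n), lcoeff β f = lcoeff β g) : f = g := by
  have : omega f = omega g := by
    ext m
    simp only [coeff_omega, h]
  rw [← mem_omegaFixed.1 hf, this, mem_omegaFixed.1 hg]

/-- The finitely many compositions of the numbers below `N`. -/
def compsBelow (N : ℕ) : Finset (Σ n, Composition n) := (Finset.range N).sigma fun _ => univ

theorem mem_compsBelow {N : ℕ} {α : Σ n, Composition n} : α ∈ compsBelow N ↔ α.1 < N := by
  simp [compsBelow]

section Triangular

variable {b : (Σ n, Composition n) → MvPowerSeries ℕ+ ℤ} {c : (Σ n, Composition n) → ℤ}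

theorem coeff_sum_of_compsBelow_subset (hb : ∀ α, b α ∈ degFiltration α.1) {m : ℕ+ →₀ ℕ} {N : ℕ}
    (hm : m.degree < N) {s : Finset (Σ n, Composition n)} (hs : compsBelow N ⊆ s) :
    MvPowerSeries.coeff m (∑ α ∈ s, c α • b α) =
      MvPowerSeries.coeff m (∑ α ∈ compsBelow N, c α • b α) := by
  rw [map_sum, map_sum]
  refine (Finset.sum_subset hs fun α _ hα => ?_).symm
  rw [mem_compsBelow, not_lt] at hα
  rw [map_zsmul, hb α m (hm.trans_le hα), smul_zero]

theorem isLinComb_iff_coeff (hb : ∀ α, b α ∈ degFiltration α.1) {f : MvPowerSeries ℕ+ ℤ} :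
    IsLinComb b c f ↔ ∀ m : ℕ+ →₀ ℕ, MvPowerSeries.coeff m f =
      MvPowerSeries.coeff m (∑ α ∈ compsBelow (m.degree + 1), c α • b α) := by
  constructor
  · intro h m
    obtain ⟨s, h1, h2⟩ := ((h (m.degree + 1)).and
      (Filter.eventually_ge_atTop (compsBelow (m.degree + 1)))).exists
    have := h1 m (Nat.lt_succ_self _)
    rw [map_sub, sub_eq_zero] at this
    rw [this, coeff_sum_of_compsBelow_subset hb (Nat.lt_succ_self _) h2]
  · intro h N
    filter_upwards [Filter.eventually_ge_atTop (compsBelow N)] with s hs m hm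
    rw [map_sub, sub_eq_zero, h]
    refine (coeff_sum_of_compsBelow_subset hb (Nat.lt_succ_self _) ?_).symm
    exact fun α hα => hs (mem_compsBelow.2 ((mem_compsBelow.1 hα).trans_le hm))

theorem exists_isLinComb (hb : ∀ α, b α ∈ degFiltration α.1) (c : (Σ n, Composition n) → ℤ) :
    ∃ f, IsLinComb b c f :=
  ⟨fun m => MvPowerSeries.coeff m (∑ α ∈ compsBelow (m.degree + 1), c α • b α),
    (isLinComb_iff_coeff hb).2 fun _ => rfl⟩

theorem lcoeff_sum {ι : Type*} {n : ℕ} (β : Composition n) (s : Finset ι)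
    (f : ι → MvPowerSeries ℕ+ ℤ) : lcoeff β (∑ i ∈ s, f i) = ∑ i ∈ s, lcoeff β (f i) :=
  map_sum (⟨⟨lcoeff β, by simp [lcoeff]⟩, lcoeff_add β⟩ : MvPowerSeries ℕ+ ℤ →+ ℤ) f s

theorem IsLinComb.lcoeff_eq (hb : ∀ α, b α ∈ degFiltration α.1)
    (ht : ∀ (n : ℕ) (α β : Composition n), lcoeff β (b ⟨n, α⟩) = if β = α then 1 else 0)
    {f : MvPowerSeries ℕ+ ℤ} (h : IsLinComb b c f) {n : ℕ} (β : Composition n) :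
    lcoeff β f = (∑ α ∈ compsBelow n, c α * lcoeff β (b α)) + c ⟨n, β⟩ := by
  rw [lcoeff_congr (g := ∑ α ∈ compsBelow (n + 1), c α • b α)
    (fun m hm => by subst hm; exact (isLinComb_iff_coeff hb).1 h m) β, lcoeff_sum]
  simp only [lcoeff_smul]
  simp only [compsBelow, Finset.sum_sigma, Finset.sum_range_succ, ht]
  simp

theorem isContinuousBasis_omegaFixed (hb : ∀ α, b α ∈ degFiltration α.1)
    (ht : ∀ (n : ℕ) (α β : Composition n), lcoeff β (b ⟨n, α⟩) = if β = α then 1 else 0)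
    (hf : ∀ α, b α ∈ omegaFixed) : IsContinuousBasis omegaFixed b := by
  refine ⟨fun c => ?_, fun f hfQ => ?_⟩
  · obtain ⟨f, h⟩ := exists_isLinComb hb c
    exact ⟨f, h.mem_omegaFixed hf, h⟩
  · have hrec : ∃ c : (Σ n, Composition n) → ℤ, ∀ (n : ℕ) (β : Composition n),
        c ⟨n, β⟩ = lcoeff β f - ∑ α ∈ compsBelow n, c α * lcoeff β (b α) := by
      let F : (n : ℕ) → ((k : ℕ) → k < n → Composition k → ℤ) → Composition n → ℤ :=
        fun n ih β => lcoeff β f - ∑ α ∈ (compsBelow n).attach,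
          ih α.1.1 (mem_compsBelow.1 α.2) α.1.2 * lcoeff β (b α)
      let d : (n : ℕ) → Composition n → ℤ := fun n =>
        WellFounded.fix (C := fun n => Composition n → ℤ) Nat.lt_wfRel.wf F n
      refine ⟨fun α => d α.1 α.2, fun n β => ?_⟩
      have : d n = F n fun k _ => d k := WellFounded.fix_eq _ F n
      simp only [this, F]
      rw [← Finset.sum_attach (compsBelow n)]
    obtain ⟨c, hc⟩ := hrec
    obtain ⟨g, hg⟩ := exists_isLinComb hb c
    have hgf : g = f := by
      refine eq_of_lcoeff_eq (hg.mem_omegaFixed hf) hfQ fun n β => ?_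
      rw [hg.lcoeff_eq hb ht, hc]
      ring
    subst hgf
    refine ⟨c, hg, fun d hd => ?_⟩
    have key : ∀ (n : ℕ) (β : Composition n), d ⟨n, β⟩ = c ⟨n, β⟩ := by
      intro n
      induction n using Nat.strong_induction_on with
      | _ n ih =>
        intro β
        have h1 := hd.lcoeff_eq hb ht β
        rw [hg.lcoeff_eq hb ht β] at h1
        have h2 : ∑ α ∈ compsBelow n, d α * lcoeff β (b α) =
            ∑ α ∈ compsBelow n, c α * lcoeff β (b α) :=
          Finset.sum_congr rfl fun α hα => by rw [ih α.1 (mem_compsBelow.1 hα) α.2]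
        rw [h2] at h1
        exact (add_left_cancel h1).symm
    exact funext fun α => key α.1 α.2

end Triangular

theorem isContinuousBasis_cellSeries (B : Bool) : IsContinuousBasis omegaFixed
    fun α : Σ n, Composition n => cellSeries α.1 B (partialSums α.2) :=
  isContinuousBasis_omegaFixed (fun _ => cellSeries_mem_degFiltration _ _ _)
    (fun _ => lcoeff_cellSeries B) fun α => mem_omegaFixed.2 (omega_omega_cellSeries B α.2)

theorem mQSym_eq_omegaFixed : mQSym = omegaFixed := by
  have h := isContinuousBasis_cellSeries true
  ext f
  simp only [mQSym, Ltilde_eq]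
  constructor
  · rintro ⟨c, hc⟩
    obtain ⟨g, hg, hgc⟩ := h.1 c
    rwa [hc.unique hgc]
  · intro hf
    obtain ⟨c, hc, -⟩ := h.2 f hf
    exact ⟨c, hc⟩

end MQSym

theorem mainTheorem9 :
    (∀ f ∈ MQSym.mQSym, MQSym.omega f ∈ MQSym.mQSym ∧ MQSym.omega (MQSym.omega f) = f) ∧
    (∀ (n : ℕ) (α : Composition n),
      MQSym.omega (MQSym.Ltilde α) = MQSym.Lhat (MQSym.omegaComp α)) ∧
    MQSym.IsContinuousBasis MQSym.mQSym
      (fun α : Σ n, Composition n => MQSym.Lhat α.2) := by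
  rw [MQSym.mQSym_eq_omegaFixed]
  refine ⟨fun f hf => ⟨?_, hf⟩, fun n α => ?_, ?_⟩
  · exact MQSym.mem_omegaFixed.2 (congrArg MQSym.omega (MQSym.mem_omegaFixed.1 hf))
  · rw [MQSym.Ltilde_eq, MQSym.Lhat_eq, MQSym.omega_cellSeries]
    rfl
  · simp only [MQSym.Lhat_eq]
    exact MQSym.isContinuousBasis_cellSeries false
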